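/- Let $\Omega$ be a nonempty outcome space and let $\mathcal P(\Omega)$ be the set of probability measures on its Borel $\sigma$-algebra. A randomized forecast is a probability measure $P$ on $\mathcal P(\Omega)$ concentrated on a finite set, and $D(P)$ denotes the smallest finite subset of $\mathcal P(\Omega)$ of $P$-probability one. Consider the following perfect-information game, with initial capitals $K_0=F_0=1$. On each round $n=1,2,\dots$: 1. Sceptic announces $S_n:\Omega\times\mathcal P(\Omega)\to\mathbb R$ that is continuous in the first argument and satisfies $\int_\Omega S_n(\omega,p)\,p(d\omega)\le 0$ for all $p\in\mathcal P(\Omega)$; 2. Forecaster announces a randomized forecast $P_n$; 3. Reality announces $\omega_n\in\Omega$; 4. Forecaster announces $f_n:\mathcal P(\Omega)\to\mathbb R$ with $\int f_n\,dP_n\le 0$; 5. Random Number Generator announces $p_n\in D(P_n)$; 6. $K_n:=K_{n-1}+S_n(\omega_n,p_n)$ and $F_n:=F_{n-1}+f_n(p_n)$. Sceptic must choose $S_n$ so that $K_n\ge 0$ no matter how the other players move, and Forecaster must choose his moves so that $F_n\ge 0$ no matter how the other players move. Assume that one of the following holds: (a) $\Omega$ is finite (with the discrete topology) and $\mathrm{dist}$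 is the Euclidean distance on the simplex $\mathcal P(\Omega)\subset\mathbb R^{\Omega}$; (b) $\Omega$ is a compact metric space and $\mathrm{dist}$ is the Prokhorov metric on $\mathcal P(\Omega)$; (c) $\Omega$ is a compact metric space and $\mathrm{dist}$ is any metric on $\mathcal P(\Omega)$ that induces the topology of weak convergence. Then for every $\epsilon>0$ and every sequence $\epsilon_1,\epsilon_2,\dots$ of positive real numbers, Forecaster has a legal strategy in this game that guarantees, for each $n$: - $K_n\le(1+\epsilon)F_n$; - $\operatorname{diam}D(P_n):=\sup_{p,q\in D(P_n)}\mathrm{dist}(p,q)\le\epsilon_n$; - $|D(P_n)|\le|\Omega|$ (which is no restriction when $\Omega$ is infinite). -/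

import Mathlib

open MeasureTheory

namespace RandomizedGame

section FiniteSupport

/-- The probability measures on `X` that are concentrated on a finite subset of `X`
(given by the weights of the points). -/
def FinProb (X : Type*) : Type _ := {P : PMF X // P.support.Finite}

variable {X : Type*}

/-- The weight `P {x}`, as a real number. -/
noncomputable def FinProb.weight (P : FinProb X) (x : X) : ℝ := (P.1 x).toReal

/-- `D(P)`: the smallest finite set of `P`-probability one. -/
noncomputable def FinProb.D (P : FinProb X) : Finset X := P.2.toFinset

/-- `D(P)` is indeed the smallest finite set of `P`-probability one. -/
theorem FinProb.D_isLeast (P : FinProb X) :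
    IsLeast {s : Finset X | P.1.toOuterMeasure (s : Set X) = 1} P.D := by
  constructor
  · refine (PMF.toOuterMeasure_apply_eq_one_iff P.1 _).2 ?_
    simp [FinProb.D]
  · intro s hs
    have h : P.1.support ⊆ (s : Set X) := (PMF.toOuterMeasure_apply_eq_one_iff P.1 _).1 hs
    intro x hx
    exact h (by simpa [FinProb.D] using hx)

theorem FinProb.D_nonempty (P : FinProb X) : P.D.Nonempty := by
  simp [FinProb.D]

/-- `∫ f dP`, which is a finite sum, so that no measurability of `f` is needed. -/
noncomputable def FinProb.integral (P : FinProb X) (f : X → ℝ) : ℝ :=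
  ∑ x ∈ P.D, P.weight x * f x

/-- The diameter `sup_{p, q ∈ s} dist (p, q)` of a finite set `s` with respect to the
distance function `d`. -/
noncomputable def diam (d : X → X → ℝ) (s : Finset X) : ℝ :=
  sSup {t : ℝ | ∃ p ∈ s, ∃ q ∈ s, t = d p q}

/-- For a nonempty finite set the supremum in the definition of `diam` is a maximum. -/
theorem diam_isGreatest (d : X → X → ℝ) {s : Finset X} (hs : s.Nonempty) :
    IsGreatest {t : ℝ | ∃ p ∈ s, ∃ q ∈ s, t = d p q} (diam d s) := by
  have hfin : {t : ℝ | ∃ p ∈ s, ∃ q ∈ s, t = d p q}.Finite := by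
    refine ((s ×ˢ s).finite_toSet.image (fun x => d x.1 x.2)).subset ?_
    rintro t ⟨p, hp, q, hq, rfl⟩
    exact ⟨(p, q), by simp [hp, hq], rfl⟩
  obtain ⟨x, hx⟩ := hs
  have hne : {t : ℝ | ∃ p ∈ s, ∃ q ∈ s, t = d p q}.Nonempty := ⟨_, x, hx, x, hx, rfl⟩
  exact ⟨hne.csSup_mem hfin, fun t ht => le_csSup hfin.bddAbove ht⟩

end FiniteSupport

section Distances

/-- The Euclidean distance on the simplex of probability measures on a finite set,
where `p` is identified with the vector `(p {ω})_ω`. -/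
noncomputable def euclideanDist {Ω : Type*} [Fintype Ω] [MeasurableSpace Ω]
    (p q : ProbabilityMeasure Ω) : ℝ :=
  dist (WithLp.toLp 2 (fun ω => (p : Measure Ω).real {ω}) : EuclideanSpace ℝ Ω)
    (WithLp.toLp 2 (fun ω => (q : Measure Ω).real {ω}))

/-- The Prokhorov distance between probability measures on a metric space. -/
noncomputable def prokhorovDist {Ω : Type*} [MetricSpace Ω] [MeasurableSpace Ω]
    (p q : ProbabilityMeasure Ω) : ℝ :=
  levyProkhorovDist (p : Measure Ω) (q : Measure Ω)

end Distances

section Game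

/-- The moves of Sceptic, Reality and Random Number Generator in one round. -/
structure Round (Ω : Type*) [MeasurableSpace Ω] where
  /-- Sceptic's function `S_n`. -/
  S : Ω → ProbabilityMeasure Ω → ℝ
  /-- Reality's outcome `ω_n`. -/
  outcome : Ω
  /-- The forecast `p_n` drawn by Random Number Generator. -/
  forecast : ProbabilityMeasure Ω

/-- A strategy for Forecaster in the game of perfect information. The list contains the
moves of the other players in the completed rounds, in chronological order (Forecaster's own
earlier moves are determined by them and by the strategy). -/
structure Strategy (Ω : Type*) [MeasurableSpace Ω] where
  /-- The randomized forecast `P_n`, chosen after Sceptic's move `S_n`. -/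
  forecast : List (Round Ω) → (Ω → ProbabilityMeasure Ω → ℝ) → FinProb (ProbabilityMeasure Ω)
  /-- The bet `f_n`, chosen after Sceptic's move `S_n` and Reality's move `ω_n`. -/
  bet : List (Round Ω) → (Ω → ProbabilityMeasure Ω → ℝ) → Ω → ProbabilityMeasure Ω → ℝ

variable {Ω : Type*} [MeasurableSpace Ω]

/-- The rounds completed before the round with index `n` (indices start from `0`, so the
round with index `n` is the `(n + 1)`-st round of the game). -/
def history (r : ℕ → Round Ω) (n : ℕ) : List (Round Ω) := (List.range n).map r

/-- The randomized forecast made by the strategy in the round with index `n`. -/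
noncomputable def Strategy.P (σ : Strategy Ω) (r : ℕ → Round Ω) (n : ℕ) :
    FinProb (ProbabilityMeasure Ω) :=
  σ.forecast (history r n) (r n).S

/-- The bet made by the strategy in the round with index `n`. -/
noncomputable def Strategy.f (σ : Strategy Ω) (r : ℕ → Round Ω) (n : ℕ) :
    ProbabilityMeasure Ω → ℝ :=
  σ.bet (history r n) (r n).S (r n).outcome

/-- Sceptic's capital after `n` rounds. -/
noncomputable def scepticCapital (r : ℕ → Round Ω) : ℕ → ℝ
  | 0 => 1
  | n + 1 => scepticCapital r n + (r n).S (r n).outcome (r n).forecast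

/-- Forecaster's capital after `n` rounds. -/
noncomputable def Strategy.capital (σ : Strategy Ω) (r : ℕ → Round Ω) : ℕ → ℝ
  | 0 => 1
  | n + 1 => σ.capital r n + σ.f r n (r n).forecast

/-- `S` is a legal move for Sceptic when his current capital is `K`: it is continuous in the
outcome, it has nonpositive expectation under every forecast, and his new capital is
nonnegative no matter how the other players move. -/
structure LegalScepticMove [TopologicalSpace Ω] (K : ℝ) (S : Ω → ProbabilityMeasure Ω → ℝ) :
    Prop where
  continuous : ∀ p, Continuous fun ω => S ω p
  integral_nonpos : ∀ p : ProbabilityMeasure Ω, ∫ ω, S ω p ∂(p : Measure Ω) ≤ 0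
  capital_nonneg : ∀ ω p, 0 ≤ K + S ω p

/-- The sequences of legal moves of the other players against Forecaster's strategy `σ`. -/
structure LegalPlay [TopologicalSpace Ω] (σ : Strategy Ω) (r : ℕ → Round Ω) : Prop where
  sceptic : ∀ n, LegalScepticMove (scepticCapital r n) (r n).S
  rng : ∀ n, (r n).forecast ∈ (σ.P r n).D

/-- The strategy `σ` obeys the rules of the game for Forecaster: `∫ f_n dP_n ≤ 0`, and
Forecaster's capital is nonnegative no matter how the other players move. -/
structure Strategy.IsLegal [TopologicalSpace Ω] (σ : Strategy Ω) : Prop where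
  integral_nonpos : ∀ r, LegalPlay σ r → ∀ n, (σ.P r n).integral (σ.f r n) ≤ 0
  capital_nonneg : ∀ r, LegalPlay σ r → ∀ n, 0 ≤ σ.capital r n

/-- Forecaster has a legal strategy that guarantees, in every round,
`K_n ≤ (1 + ε) F_n`, `diam D(P_n) ≤ ε_n` (with respect to the distance `d` on forecasts) and
`|D(P_n)| ≤ |Ω|`. The bound for the round with index `n` is `e n`. -/
def ForecasterCanGuarantee [TopologicalSpace Ω]
    (d : ProbabilityMeasure Ω → ProbabilityMeasure Ω → ℝ) (ε : ℝ) (e : ℕ → ℝ) : Prop :=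
  ∃ σ : Strategy Ω, σ.IsLegal ∧ ∀ r, LegalPlay σ r →
    (∀ n, scepticCapital r n ≤ (1 + ε) * σ.capital r n) ∧
    (∀ n, diam d (σ.P r n).D ≤ e n) ∧
    (∀ n, ((σ.P r n).D.card : ℕ∞) ≤ ENat.card Ω)

end Game

end RandomizedGame

/-!
In each round Forecaster needs a finitely supported mixture of forecasts, concentrated near a single
one, under which Sceptic's expected gain is at most a small `δ` for every outcome. Against such a
mixture Forecaster can keep his capital equal to `(K + ε / 2 ^ n) / (1 + ε)`, where `K` is Sceptic's
capital after `n` rounds: his bet copies Sceptic's gain up to the factor `1 + ε`, and the decrease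
of `ε / 2 ^ n` pays for `δ` (`forecasterCanGuarantee_of_nhds`).

The mixture is found as follows (`exists_local_mixture_le`). Sceptic's bet at a forecast `q` is
continuous in the outcome and has nonpositive mean under `q`, so it has mean less than `δ` under
all forecasts `p` in a neighbourhood of `q`. Finitely many of these neighbourhoods cover the
compact space of forecasts. Mixing the bets at their centres with a partition of unity evaluated
at `p` gives a bet that depends continuously on `p` and has mean at most `δ` under `p`. By a
Ky Fan inequality (`exists_forecast_forall_nonpos`) there is a `p` for which this bet gains at most
`δ` at every outcome; the weights of the mixture are the values of the partition of unity at `p`.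
Carathéodory's theorem for cones bounds the number of forecasts by the number of outcomes
(`exists_pos_combination_card_le_finrank`).

The Ky Fan inequality follows by compactness from its case of finitely many outcomes, a variational
inequality on a simplex (`exists_forall_nonpos_of_sum_mul_nonpos`), which is deduced from
Brouwer's theorem (`exists_fixedPoint_stdSimplex`). Brouwer's theorem is proved
by Scarf's combinatorial argument (`exists_isPrimitive_image_eq_univ`): primitive sets of lattice
points and slack elements take the place of the cells of a triangulation, and counting incidences
between full primitive sets ("rooms") and those with one element less ("doors") modulo 2 yields one
that carries all the colours. Fine lattices then give approximate fixed points.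
-/

/-! ### Scarf's lemma -/

section Scarf

variable {V I : Type*}

/-- A set `X` is *primitive* for the rank functions `r i` if no element of `V` lies strictly above
the `r i`-minimum of `X` for every `i` at once. -/
def IsPrimitive (r : I → V → ℕ) (X : Finset V) : Prop :=
  ∀ y, ∃ i, ∀ x ∈ X, r i y ≤ r i x

variable {r : I → V → ℕ} {Y : Finset V}

theorem IsPrimitive.mono {X Y : Finset V} (hX : IsPrimitive r X) (hYX : Y ⊆ X) :
    IsPrimitive r Y := fun y =>
  (hX y).imp fun _ hi x hx => hi x (hYX hx)

/-- In a primitive set with as many elements as there are indices, no element is the minimum for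
two indices: the choice of an index for each element is injective, hence bijective. -/
theorem IsPrimitive.eq_of_isMin [Fintype I] (hr : ∀ i, Function.Injective (r i))
    {X : Finset V} (hX : IsPrimitive r X) (hcard : X.card = Fintype.card I) {i j : I} {x : V}
    (hx : x ∈ X) (hi : ∀ z ∈ X, r i x ≤ r i z) (hj : ∀ z ∈ X, r j x ≤ r j z) : i = j := by
  classical
  choose g hg using fun x : X => hX x
  have ginj : Function.Injective g := by
    intro a b hab
    apply Subtype.ext
    apply hr (g a)
    exact le_antisymm (hg a b b.2) (by rw [hab]; exact hg b a a.2)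
  have gbij : Function.Bijective g :=
    (Fintype.bijective_iff_injective_and_card g).2 ⟨ginj, by simpa using hcard⟩
  obtain ⟨a, rfl⟩ := gbij.2 i
  obtain ⟨b, rfl⟩ := gbij.2 j
  have ha : (a : V) = x := hr (g a) (le_antisymm (hg a x hx) (hi a a.2))
  have hb : (b : V) = x := hr (g b) (le_antisymm (hg b x hx) (hj b b.2))
  rw [Subtype.ext (ha.trans hb.symm)]

/-- `Above r Y i y` says that `y` lies strictly above the `r k`-minimum of `Y`
for every index `k ≠ i`. -/
def Above (r : I → V → ℕ) (Y : Finset V) (i : I) (y : V) : Prop :=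
  ∀ k, k ≠ i → ∃ x ∈ Y, r k x < r k y

theorem IsPrimitive.le_of_above (hY : IsPrimitive r Y) {i : I} {y : V}
    (h : Above r Y i y) : ∀ x ∈ Y, r i y ≤ r i x := by
  obtain ⟨k, hk⟩ := hY y
  by_cases hki : k = i
  · exact hki ▸ hk
  · obtain ⟨x, hx, hlt⟩ := h k hki
    exact absurd (hk x hx) (not_le.2 hlt)

/-- If some element is above `Y` in the sense of `Above r Y i`, exactly one such element extends
`Y` to a primitive set, namely the `r i`-largest one. -/
theorem IsPrimitive.existsUnique_above [Fintype V] [DecidableEq V]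
    (hr : ∀ i, Function.Injective (r i)) (hY : IsPrimitive r Y) {i : I}
    (hne : ∃ y, Above r Y i y) : ∃! y, Above r Y i y ∧ IsPrimitive r (insert y Y) := by
  classical
  obtain ⟨y, hy, hmax⟩ := Finset.exists_max_image (Finset.univ.filter (Above r Y i)) (r i)
    (by simpa [Finset.filter_nonempty_iff] using hne)
  simp only [Finset.mem_filter, Finset.mem_univ, true_and] at hy hmax
  have key : ∀ y, Above r Y i y → IsPrimitive r (insert y Y) →
      ∀ z, Above r Y i z → r i z ≤ r i y := by
    intro y _ hp z hz
    obtain ⟨k, hk⟩ := hp z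
    by_cases hki : k = i
    · exact hki ▸ hk y (Finset.mem_insert_self _ _)
    · obtain ⟨x, hx, hlt⟩ := hz k hki
      exact absurd (hk x (Finset.mem_insert_of_mem hx)) (not_le.2 hlt)
  refine ⟨y, ⟨hy, fun z => ?_⟩, fun z ⟨hz, hzp⟩ =>
    hr i (le_antisymm (hmax z hz) (key z hz hzp y hy))⟩
  by_contra! hcon
  have hz : Above r Y i z := by
    intro k hki
    obtain ⟨x, hx, hlt⟩ := hcon k
    rcases Finset.mem_insert.1 hx with rfl | hx
    · obtain ⟨x', hx', hlt'⟩ := hy k hki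
      exact ⟨x', hx', hlt'.trans hlt⟩
    · exact ⟨x, hx, hlt⟩
  obtain ⟨x, hx, hlt⟩ := hcon i
  rcases Finset.mem_insert.1 hx with rfl | hx
  · exact absurd (hmax z hz) (not_le.2 hlt)
  · exact absurd (hY.le_of_above hz x hx) (not_le.2 hlt)

/-- A primitive set `Y` with one element less than there are indices assigns one of its elements
as minimum to two indices `i ≠ j`. An element that extends `Y` to a primitive set becomes the
minimum for one of these two, and for each of them there is exactly one such extension. -/
theorem IsPrimitive.card_extensions_eq_two [Fintype V] [Fintype I] [DecidableEq V]
    [DecidablePred fun y => IsPrimitive r (insert y Y)]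
    (hr : ∀ i, Function.Injective (r i)) (hY : IsPrimitive r Y) (hne : Y.Nonempty)
    (hcard : Y.card + 1 = Fintype.card I) (habove : ∀ i, ∃ y, Above r Y i y) :
    (Yᶜ.filter fun y => IsPrimitive r (insert y Y)).card = 2 := by
  choose m hm using fun i => Finset.exists_min_image Y (r i) hne
  obtain ⟨i, -, j, -, hij, hmij⟩ := Finset.exists_ne_map_eq_of_card_lt_of_maps_to
    (s := Finset.univ) (t := Y) (f := m) (by rw [Finset.card_univ]; omega) (fun i _ => (hm i).1)
  have hnot : ∀ i j, i ≠ j → m i = m j → ∀ y, Above r Y i y → y ∉ Y := by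
    intro i j hij hmij y hy hyY
    have hym : y = m i :=
      hr i (le_antisymm (hY.le_of_above hy _ (hm i).1) ((hm i).2 y hyY))
    obtain ⟨x, hx, hlt⟩ := hy j hij.symm
    rw [hym, hmij] at hlt
    exact absurd ((hm j).2 x hx) (not_le.2 hlt)
  have hcases : ∀ y, y ∉ Y → IsPrimitive r (insert y Y) → Above r Y i y ∨ Above r Y j y := by
    intro y hyY hp
    have hc : (insert y Y).card = Fintype.card I := by
      rw [Finset.card_insert_of_notMem hyY, hcard]
    obtain ⟨k, hk⟩ := hp y
    have hky : Above r Y k y := by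
      intro l hl
      by_contra! hcon
      exact hl (hp.eq_of_isMin hr hc (Finset.mem_insert_self y Y)
        (by simpa using hcon) hk)
    by_cases hki : i = k
    · exact Or.inl (hki ▸ hky)
    by_cases hkj : j = k
    · exact Or.inr (hkj ▸ hky)
    have hmin : ∀ l, l ≠ k → ∀ z ∈ insert y Y, r l (m l) ≤ r l z := by
      intro l hl z hz
      rcases Finset.mem_insert.1 hz with rfl | hz
      · obtain ⟨x, hx, hlt⟩ := hky l hl
        exact ((hm l).2 x hx).trans hlt.le
      · exact (hm l).2 z hz
    exact absurd (hp.eq_of_isMin hr hc (Finset.mem_insert_of_mem (hm i).1) (hmin i hki)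
      (hmij ▸ hmin j hkj)) hij
  obtain ⟨a, ⟨ha, hap⟩, hau⟩ := hY.existsUnique_above hr (habove i)
  obtain ⟨b, ⟨hb, hbp⟩, hbu⟩ := hY.existsUnique_above hr (habove j)
  have hab : a ≠ b := by
    rintro rfl
    obtain ⟨x, hx, hlt⟩ := hb i hij
    exact absurd (hY.le_of_above ha x hx) (not_le.2 hlt)
  refine Finset.card_eq_two.2 ⟨a, b, hab, ?_⟩
  ext y
  simp only [Finset.mem_filter, Finset.mem_compl, Finset.mem_insert, Finset.mem_singleton]
  constructor
  · rintro ⟨hyY, hp⟩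
    exact (hcases y hyY hp).imp (fun h => hau y ⟨h, hp⟩) fun h => hbu y ⟨h, hp⟩
  · rintro (rfl | rfl)
    · exact ⟨hnot i j hij hmij _ ha, hap⟩
    · exact ⟨hnot j i hij.symm hmij.symm _ hb, hbp⟩

/-- If a set `X` of as many elements as there are colours does not meet every colour, then the
number of `x ∈ X` whose removal leaves exactly the colours other than `i₀` is even
(it is `0` or `2`). -/
theorem even_card_erase_filter [Fintype I] [DecidableEq V] [DecidableEq I] (c : V → I) (i₀ : I)
    {X : Finset V} (hcard : X.card = Fintype.card I) (hX : X.image c ≠ Finset.univ) :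
    Even (X.filter fun x => (X.erase x).image c = Finset.univ.erase i₀).card := by
  rcases (X.filter fun x => (X.erase x).image c = Finset.univ.erase i₀).eq_empty_or_nonempty with
    h | ⟨x, hx⟩
  · simp [h]
  obtain ⟨hxX, hx⟩ := Finset.mem_filter.1 hx
  have hXx : X.image c = insert (c x) (Finset.univ.erase i₀) := by
    rw [← hx, ← Finset.image_insert, Finset.insert_erase hxX]
  have hcx : c x ≠ i₀ := by
    rintro h
    rw [h, Finset.insert_erase (Finset.mem_univ _)] at hXx
    exact hX hXx
  obtain ⟨x', hx', hcx'⟩ := Finset.mem_image.1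
    (show c x ∈ (X.erase x).image c by rw [hx]; simp [hcx])
  obtain ⟨hne, hx'X⟩ := Finset.mem_erase.1 hx'
  have hinj : ∀ z ∈ X, (X.erase z).image c = Finset.univ.erase i₀ →
      Set.InjOn c (X.erase z : Finset V) := by
    intro z hz h
    apply Finset.card_image_iff.1
    rw [h, Finset.card_erase_of_mem (Finset.mem_univ _), Finset.card_erase_of_mem hz, hcard,
      Finset.card_univ]
  suffices X.filter (fun x => (X.erase x).image c = Finset.univ.erase i₀) = {x', x} by
    rw [this, Finset.card_pair hne]
    exact even_two
  ext z
  simp only [Finset.mem_filter, Finset.mem_insert, Finset.mem_singleton]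
  constructor
  · rintro ⟨hz, h⟩
    by_contra! hcon
    exact hne (hinj z hz h (by simpa using ⟨hx'X, hcon.1.symm⟩)
      (by simpa using ⟨hxX, hcon.2.symm⟩) hcx')
  · rintro (rfl | rfl)
    · refine ⟨hx'X, ?_⟩
      rw [← hx]
      have h1 : X.erase z = insert x ((X.erase x).erase z) := by
        rw [Finset.erase_right_comm, Finset.insert_erase]
        exact Finset.mem_erase.2 ⟨hne.symm, hxX⟩
      rw [h1, Finset.image_insert, ← hcx', ← Finset.image_insert, Finset.insert_erase hx']
    · exact ⟨hxX, hx⟩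

/-- **Scarf's lemma**, in the form of a colouring theorem. The *slack* element `s i` is the lowest
one for the index `i` and lies above every non-slack element for the other indices. If each slack
element `s i` has colour `i`, then some primitive set contains every colour exactly once. -/
theorem exists_isPrimitive_image_eq_univ [Fintype V] [Fintype I] [Nonempty I] [DecidableEq I]
    (hr : ∀ i, Function.Injective (r i)) (s : I → V) (hs : ∀ i v, r i (s i) ≤ r i v)
    (hs' : ∀ v, v ∉ Set.range s → ∀ i k, i ≠ k → r k v < r k (s i))
    (hne : ∃ v, v ∉ Set.range s) (c : V → I) (hc : ∀ i, c (s i) = i) :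
    ∃ X : Finset V, IsPrimitive r X ∧ X.card = Fintype.card I ∧ X.image c = Finset.univ := by
  classical
  by_contra! hcon
  obtain ⟨i₀⟩ := ‹Nonempty I›
  have hsinj : Function.Injective s := fun i j h => by rw [← hc i, h, hc]
  -- a room and a door are incident if the door is a subset of the room
  let rooms : Finset (Finset V) :=
    Finset.univ.filter fun X => IsPrimitive r X ∧ X.card = Fintype.card I
  let doors : Finset (Finset V) :=
    Finset.univ.filter fun Y => IsPrimitive r Y ∧ Y.card + 1 = Fintype.card I ∧
      Y.image c = Finset.univ.erase i₀
  let Y₀ : Finset V := (Finset.univ.erase i₀).image s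
  -- the number of doors of a room is even, as no room contains all the colours
  have hrooms : ∀ X ∈ rooms, Even (Finset.bipartiteBelow (· ⊆ ·) doors X).card := by
    intro X hX
    simp only [rooms, Finset.mem_filter, Finset.mem_univ, true_and] at hX
    have : Finset.bipartiteBelow (· ⊆ ·) doors X =
        (X.filter fun x => (X.erase x).image c = Finset.univ.erase i₀).image X.erase := by
      ext Y
      simp only [Finset.bipartiteBelow, doors, Finset.mem_filter, Finset.mem_univ, true_and,
        Finset.mem_image]
      constructor
      · rintro ⟨⟨-, hYc, hY⟩, hYX⟩
        obtain ⟨x, hxX, rfl⟩ : ∃ x ∈ X, X.erase x = Y := by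
          obtain ⟨x, hxY, rfl⟩ := (Finset.covBy_iff_exists_insert (s := Y) (t := X)).1
            (Finset.covBy_iff_card_sdiff_eq_one.2 ⟨hYX, by
              rw [Finset.card_sdiff_of_subset hYX]; omega⟩)
          exact ⟨x, Finset.mem_insert_self _ _, Finset.erase_insert hxY⟩
        exact ⟨x, ⟨hxX, hY⟩, rfl⟩
      · rintro ⟨x, ⟨hxX, hx⟩, rfl⟩
        exact ⟨⟨hX.1.mono (Finset.erase_subset _ _), by
          rw [Finset.card_erase_add_one hxX, hX.2], hx⟩, Finset.erase_subset _ _⟩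
    rw [this, Finset.card_image_of_injOn]
    · exact even_card_erase_filter c i₀ hX.2 (hcon X hX.1 hX.2)
    · exact (Finset.erase_injOn X).mono fun x hx => (Finset.mem_filter.1 hx).1
  have habv : ∀ Y ∈ doors, (Finset.bipartiteAbove (· ⊆ ·) rooms Y).card =
      (Yᶜ.filter fun y => IsPrimitive r (insert y Y)).card := by
    intro Y hY
    simp only [doors, Finset.mem_filter, Finset.mem_univ, true_and] at hY
    symm
    apply Finset.card_bij (fun y _ => insert y Y)
    · intro y hy
      simp only [Finset.mem_filter, Finset.mem_compl] at hy
      simp [Finset.bipartiteAbove, rooms, hy.2, Finset.card_insert_of_notMem hy.1, hY.2.1]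
    · intro a ha b hb hab
      simp only [Finset.mem_filter, Finset.mem_compl] at ha hb
      exact (Finset.insert_inj ha.1).1 hab
    · intro X hX
      simp only [Finset.bipartiteAbove, rooms, Finset.mem_filter, Finset.mem_univ,
        true_and] at hX
      obtain ⟨x, hxY, rfl⟩ := (Finset.covBy_iff_exists_insert (s := Y) (t := X)).1
        (Finset.covBy_iff_card_sdiff_eq_one.2 ⟨hX.2, by
          rw [Finset.card_sdiff_of_subset hX.2]; omega⟩)
      exact ⟨x, by simpa [hxY] using hX.1.1, rfl⟩
  -- a door with a non-slack element leads to exactly two rooms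
  have hdoors : ∀ Y ∈ doors.erase Y₀, Even (Finset.bipartiteAbove (· ⊆ ·) rooms Y).card := by
    intro Y hY
    obtain ⟨hY₀, hYd⟩ := Finset.mem_erase.1 hY
    rw [habv Y hYd]
    simp only [doors, Finset.mem_filter, Finset.mem_univ, true_and] at hYd
    obtain ⟨t, htY, ht⟩ : ∃ t ∈ Y, t ∉ Set.range s := by
      by_contra! hsub
      refine hY₀ ?_
      have : Y = (Y.image c).image s := by
        rw [Finset.image_image]
        conv_lhs => rw [← Finset.image_id (s := Y)]
        refine Finset.image_congr fun v hv => ?_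
        obtain ⟨i, rfl⟩ := hsub v hv
        simp [hc]
      rw [this, hYd.2.2]
    rw [hYd.1.card_extensions_eq_two hr ⟨t, htY⟩ hYd.2.1
      fun i => ⟨s i, fun k hk => ⟨t, htY, hs' t ht i k hk.symm⟩⟩]
    exact even_two
  -- the door made of slack elements leads to one room only
  have hY₀d : Y₀ ∈ doors := by
    simp only [doors, Finset.mem_filter, Finset.mem_univ, true_and]
    refine ⟨fun y => ?_, ?_, ?_⟩
    · by_cases hy : y ∈ Set.range s
      · obtain ⟨k, rfl⟩ := hy
        exact ⟨k, fun x _ => hs k x⟩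
      · refine ⟨i₀, fun x hx => ?_⟩
        obtain ⟨k, hk, rfl⟩ := Finset.mem_image.1 hx
        exact (hs' y hy k i₀ (Finset.ne_of_mem_erase hk)).le
    · rw [Finset.card_image_of_injective _ hsinj, Finset.card_erase_add_one (Finset.mem_univ _),
        Finset.card_univ]
    · rw [Finset.image_image, show c ∘ s = id from funext hc, Finset.image_id]
  have hY₀c : (Finset.bipartiteAbove (· ⊆ ·) rooms Y₀).card = 1 := by
    rw [habv Y₀ hY₀d]
    simp only [doors, Finset.mem_filter, Finset.mem_univ, true_and] at hY₀d
    have habove : ∀ v, v ∉ Set.range s → Above r Y₀ i₀ v := fun v hv k hk =>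
      ⟨s k, by simp [Y₀, hk, hsinj.eq_iff], lt_of_le_of_ne (hs k v) fun h =>
        hv ⟨k, hr k h⟩⟩
    obtain ⟨v, hv⟩ := hne
    obtain ⟨y, ⟨hy, hyp⟩, hyu⟩ := hY₀d.1.existsUnique_above hr ⟨v, habove v hv⟩
    refine Finset.card_eq_one.2 ⟨y, ?_⟩
    ext z
    simp only [Finset.mem_filter, Finset.mem_compl, Finset.mem_singleton]
    constructor
    · rintro ⟨hz, hzp⟩
      refine hyu z ⟨habove z ?_, hzp⟩
      -- all the slack elements together do not form a primitive set
      rintro ⟨k, rfl⟩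
      have hk : k = i₀ := by
        by_contra hk
        exact hz (by simp [Y₀, hk, hsinj.eq_iff])
      subst hk
      obtain ⟨i, hi⟩ := hzp v
      refine hv ⟨i, hr i (le_antisymm (hs i v) (hi (s i) ?_))⟩
      by_cases h : i = k <;> simp [Y₀, h, hsinj.eq_iff]
    · rintro rfl
      refine ⟨fun hzY => ?_, hyp⟩
      obtain ⟨k, hk, rfl⟩ := Finset.mem_image.1 hzY
      obtain ⟨x, _, hlt⟩ := hy k (Finset.ne_of_mem_erase hk)
      exact absurd (hs k x) (not_le.2 hlt)
  have hsum := Finset.sum_card_bipartiteAbove_eq_sum_card_bipartiteBelow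
    (s := doors) (t := rooms) (· ⊆ ·)
  rw [← Finset.add_sum_erase _ _ hY₀d, hY₀c] at hsum
  have h1 : Even (∑ Y ∈ doors.erase Y₀, (Finset.bipartiteAbove (· ⊆ ·) rooms Y).card) :=
    Finset.even_sum _ hdoors
  have h2 := Finset.even_sum _ hrooms
  rw [← hsum, Nat.even_add] at h2
  exact Nat.not_even_one (h2.2 h1)

end Scarf

/-! ### Brouwer's fixed point theorem on the simplex -/

section Brouwer

open Filter Topology

/-- If the lattice points of the simplex of size `N` are coloured, there is a point `p` such that
every colour `i` occurs within a distance independent of `N` of `p`, unless `p` itself is within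
that distance of the face `x i = 0`. -/
theorem exists_close_colors {I : Type*} [Fintype I] [Nonempty I] (N : ℕ) (c : (I → ℕ) → I) :
    ∃ p : I → ℕ, ∑ k, p k = N ∧ ∀ i, p i ≤ Fintype.card I ∨
      ∃ q : I → ℕ, ∑ k, q k = N ∧ c q = i ∧
        ∀ k, q k ≤ p k + (Fintype.card I + 1) ∧ p k ≤ q k + (Fintype.card I + 1) := by
  classical
  let T := {x : I → ℕ // x ∈ Finset.piAntidiag Finset.univ N}
  let _ : Fintype T := Finset.Subtype.fintype _
  have hT : ∀ x : T, ∑ k, x.1 k = N := fun x => (Finset.mem_piAntidiag.1 x.2).1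
  have hTle : ∀ (x : T) i, x.1 i ≤ N := fun x i =>
    (Finset.single_le_sum (fun _ _ => Nat.zero_le _) (Finset.mem_univ i)).trans (hT x).le
  let M := Fintype.card T
  let t : T ≃ Fin M := Fintype.equivFin T
  let e : I ≃ Fin (Fintype.card I) := Fintype.equivFin I
  -- the lattice points are ranked by their `i`-th coordinate, with ties broken by `t`
  let r : I → T ⊕ I → ℕ := fun i => Sum.elim (fun x => x.1 i * M + t x + 1)
    fun k => if k = i then 0 else N * M + M + 1 + e k
  have hrl : ∀ i (x : T), r i (Sum.inl x) = x.1 i * M + t x + 1 := fun _ _ => rfl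
  have hrr : ∀ i k, r i (Sum.inr k) = if k = i then 0 else N * M + M + 1 + e k :=
    fun _ _ => rfl
  have hle : ∀ i (x : T), r i (Sum.inl x) < N * M + M + 1 := by
    intro i x
    have h1 := Nat.mul_le_mul_right M (hTle x i)
    have h2 := (t x).2
    rw [hrl]
    omega
  have hlt : ∀ i (x y : T), x.1 i + 1 ≤ y.1 i → r i (Sum.inl x) < r i (Sum.inl y) := by
    intro i x y h
    have h1 := Nat.mul_le_mul_right M h
    have h2 := (t x).2
    rw [hrl, hrl]
    rw [Nat.add_mul, one_mul] at h1
    omega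
  have hinj : ∀ i, Function.Injective (r i) := by
    rintro i (x | k) (y | l) h
    · rw [hrl, hrl] at h
      have h1 : (x.1 i * M + t x) % M = (y.1 i * M + t y) % M := by
        rw [Nat.add_right_cancel h]
      rw [Nat.mul_add_mod', Nat.mul_add_mod', Nat.mod_eq_of_lt (t x).2,
        Nat.mod_eq_of_lt (t y).2] at h1
      rw [t.injective (Fin.ext h1)]
    · have := hle i x
      rw [h, hrr] at this
      rw [hrl, hrr] at h
      split_ifs at *; omega
    · have := hle i y
      rw [← h, hrr] at this
      rw [hrl, hrr] at h
      split_ifs at *; omega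
    · rw [hrr, hrr] at h
      have hkl : k = l := by
        split_ifs at h with h1 h2 h2
        · rw [h1, h2]
        · omega
        · omega
        · exact e.injective (Fin.ext (by omega))
      rw [hkl]
  have hT0 : ∀ l : I → ℕ, ∑ k, l k ≤ N → ∃ y : T, ∀ k, l k ≤ y.1 k := by
    intro l hl
    obtain ⟨i₀⟩ := ‹Nonempty I›
    refine ⟨⟨l + Pi.single i₀ (N - ∑ k, l k), Finset.mem_piAntidiag.2 ⟨?_, by simp⟩⟩,
      fun k => by simp⟩
    simp only [Pi.add_apply, Finset.sum_add_distrib, Finset.sum_pi_single', Finset.mem_univ,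
      if_true]
    omega
  obtain ⟨y₀, -⟩ := hT0 0 (by simp)
  obtain ⟨X, hX, -, hXc⟩ := exists_isPrimitive_image_eq_univ (r := r) hinj Sum.inr
    (fun i v => by simp [hrr])
    (by
      rintro (x | k) hv i k hik
      · have := hle k x
        rw [hrr, if_neg hik]
        omega
      · exact absurd ⟨_, rfl⟩ hv)
    ⟨Sum.inl y₀, by simp⟩ (Sum.elim (fun x => c x.1) id) (fun i => rfl)
  have hcol : ∀ i, Sum.inr i ∈ X ∨ ∃ x : T, Sum.inl x ∈ X ∧ c x.1 = i := by
    intro i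
    obtain ⟨v, hv, hvi⟩ := Finset.mem_image.1 (hXc ▸ Finset.mem_univ i)
    rcases v with x | k
    · exact Or.inr ⟨x, hv, hvi⟩
    · have : k = i := hvi
      exact Or.inl (this ▸ hv)
  obtain ⟨p, hp⟩ : ∃ x : T, Sum.inl x ∈ X := by
    by_contra! hcon
    obtain ⟨i, hi⟩ := hX (Sum.inl y₀)
    rcases hcol i with h | ⟨x, hx, -⟩
    · have := hi _ h
      rw [hrl, hrr, if_pos rfl] at this
      omega
    · exact hcon x hx
  -- `l i` is the least value of a coordinate that lies above the minimum over `X`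
  have hl : ∀ i, ∃ l : ℕ, (∀ x : T, Sum.inl x ∈ X → l ≤ x.1 i + 1) ∧
      (∀ y : T, l ≤ y.1 i → ∃ v ∈ X, r i v < r i (Sum.inl y)) ∧ (Sum.inr i ∈ X → l = 0) := by
    intro i
    by_cases hi : Sum.inr i ∈ X
    · exact ⟨0, fun _ _ => Nat.zero_le _, fun y _ => ⟨_, hi, by simp [hrr, hrl]⟩, fun _ => rfl⟩
    · obtain ⟨x, hx, hmin⟩ := Finset.exists_min_image
        (Finset.univ.filter fun x : T => Sum.inl x ∈ X) (fun x => x.1 i) ⟨p, by simpa using hp⟩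
      simp only [Finset.mem_filter, Finset.mem_univ, true_and] at hx hmin
      exact ⟨x.1 i + 1, fun z hz => Nat.succ_le_succ (hmin z hz),
        fun y hy => ⟨_, hx, hlt i x y hy⟩, fun h => absurd h hi⟩
  choose l hl1 hl2 hl3 using hl
  have hlN : N < ∑ k, l k := by
    by_contra! hcon
    obtain ⟨y, hy⟩ := hT0 l hcon
    obtain ⟨i, hi⟩ := hX (Sum.inl y)
    obtain ⟨v, hv, hlt⟩ := hl2 i y (hy i)
    exact absurd (hi v hv) (not_le.2 hlt)
  have hup : ∀ x : T, Sum.inl x ∈ X → ∀ i, x.1 i ≤ l i + Fintype.card I := by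
    intro x hx i
    have h1 := Finset.add_sum_erase Finset.univ x.1 (Finset.mem_univ i)
    have h2 := Finset.add_sum_erase Finset.univ l (Finset.mem_univ i)
    have h3 : ∑ k ∈ Finset.univ.erase i, l k ≤ ∑ k ∈ Finset.univ.erase i, (x.1 k + 1) :=
      Finset.sum_le_sum fun k _ => hl1 k x hx
    rw [Finset.sum_add_distrib, Finset.sum_const, smul_eq_mul, mul_one,
      Finset.card_erase_of_mem (Finset.mem_univ _), Finset.card_univ] at h3
    have h4 := hT x
    omega
  refine ⟨p.1, hT p, fun i => ?_⟩
  rcases hcol i with h | ⟨q, hq, hqi⟩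
  · left
    have := hup p hp i
    rw [hl3 i h] at this
    omega
  · refine Or.inr ⟨q.1, hT q, hqi, fun k => ?_⟩
    have h1 := hup p hp k
    have h2 := hup q hq k
    have h3 := hl1 k p hp
    have h4 := hl1 k q hq
    omega

/-- **Brouwer's fixed point theorem** for the standard simplex. -/
theorem exists_fixedPoint_stdSimplex {I : Type*} [Fintype I] [Nonempty I]
    (f : stdSimplex ℝ I → stdSimplex ℝ I) (hf : Continuous f) : ∃ x, f x = x := by
  classical
  set K : ℕ := Fintype.card I
  -- it suffices to find a point whose image is nowhere smaller, as coordinates sum to `1`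
  suffices h : ∃ x : stdSimplex ℝ I, ∀ i, x.1 i ≤ (f x).1 i by
    obtain ⟨x, hx⟩ := h
    refine ⟨x, Subtype.ext (funext fun i => ?_)⟩
    exact ((Finset.sum_eq_sum_iff_of_le fun i _ => hx i).1
      (x.2.2.trans (f x).2.2.symm) i (Finset.mem_univ i)).symm
  have hcolor : ∀ x : stdSimplex ℝ I, ∃ i, x.1 i ≤ (f x).1 i := fun x => by
    obtain ⟨i, -, hi⟩ := Finset.exists_le_of_sum_le (s := Finset.univ) (f := x.1) (g := (f x).1)
      Finset.univ_nonempty (x.2.2.trans (f x).2.2.symm).le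
    exact ⟨i, hi⟩
  choose color hcolor using hcolor
  have happrox : ∀ n : ℕ, ∃ p : stdSimplex ℝ I, ∀ i, p.1 i ≤ K / ((n : ℝ) + 1) ∨
      ∃ q : stdSimplex ℝ I, q.1 i ≤ (f q).1 i ∧
        ∀ k, dist (q.1 k) (p.1 k) ≤ (K + 1) / ((n : ℝ) + 1) := by
    intro n
    have hn : (0 : ℝ) < (n : ℝ) + 1 := by positivity
    have hmem : ∀ x : I → ℕ, ∑ k, x k = n + 1 →
        (fun k => (x k : ℝ) / ((n : ℝ) + 1)) ∈ stdSimplex ℝ I := fun x hx => by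
      refine ⟨fun k => by positivity, ?_⟩
      rw [← Finset.sum_div, div_eq_one_iff_eq hn.ne']
      exact_mod_cast hx
    obtain ⟨p, hp, hpq⟩ := exists_close_colors (n + 1) fun x =>
      if hx : ∑ k, x k = n + 1 then color ⟨_, hmem x hx⟩ else Classical.arbitrary I
    refine ⟨⟨_, hmem p hp⟩, fun i => (hpq i).imp (fun h => ?_) ?_⟩
    · exact div_le_div_of_nonneg_right (by exact_mod_cast h) hn.le
    · rintro ⟨q, hq, hqi, hclose⟩
      refine ⟨⟨_, hmem q hq⟩, ?_, fun k => ?_⟩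
      · rw [dif_pos hq] at hqi
        subst hqi
        exact hcolor _
      · have h1 : (q k : ℝ) ≤ p k + (K + 1) := by exact_mod_cast (hclose k).1
        have h2 : (p k : ℝ) ≤ q k + (K + 1) := by exact_mod_cast (hclose k).2
        rw [Real.dist_eq, ← sub_div, abs_div, abs_of_pos hn]
        exact div_le_div_of_nonneg_right (abs_le.2 ⟨by linarith, by linarith⟩) hn.le
  choose p hp using happrox
  obtain ⟨x, φ, hφ, hlim⟩ := CompactSpace.tendsto_subseq p
  have htend : ∀ C : ℝ, Tendsto (fun n => C / ((φ n : ℝ) + 1)) atTop (𝓝 0) := fun C =>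
    (tendsto_const_div_atTop_nhds_zero_nat C |>.comp (tendsto_add_atTop_nat 1) |>.comp
      hφ.tendsto_atTop).congr fun n => by simp
  refine ⟨x, fun i => ?_⟩
  by_contra! hlt
  have hcont : ∀ i, Continuous fun y : stdSimplex ℝ I => y.1 i := fun i =>
    (continuous_apply i).comp continuous_subtype_val
  have hopen : IsOpen {y : stdSimplex ℝ I | (f y).1 i < y.1 i} :=
    isOpen_lt ((hcont i).comp hf) (hcont i)
  obtain ⟨δ, hδ, hball⟩ := Metric.isOpen_iff.1 hopen x hlt
  have h1 : ∀ᶠ n in atTop, dist (p (φ n)) x < δ / 2 :=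
    hlim.eventually (Metric.ball_mem_nhds x (half_pos hδ))
  have h2 : ∀ᶠ n in atTop, (K + 1) / ((φ n : ℝ) + 1) < δ / 2 :=
    (htend _).eventually_lt_const (half_pos hδ)
  have h3 : ∀ᶠ n in atTop, K / ((φ n : ℝ) + 1) < (p (φ n)).1 i :=
    (htend _).eventually_lt (((hcont i).tendsto x).comp hlim) (((f x).2.1 i).trans_lt hlt)
  obtain ⟨n, h1, h2, h3⟩ := (h1.and (h2.and h3)).exists
  rcases hp (φ n) i with h | ⟨q, hq, hqp⟩
  · exact absurd h (not_le.2 h3)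
  · have hdist : dist q (p (φ n)) ≤ (K + 1) / ((φ n : ℝ) + 1) :=
      (dist_pi_le_iff (by positivity)).2 hqp
    have hqx : q ∈ Metric.ball x δ := by
      have := dist_triangle q (p (φ n)) x
      rw [Metric.mem_ball]
      linarith
    exact absurd hq (not_le.2 (hball hqx))

/-- The variational inequality for a continuous vector field `g` on the simplex with
`⟨x, g x⟩ ≤ 0`: somewhere all components of `g` are nonpositive. -/
theorem exists_forall_nonpos_of_sum_mul_nonpos {I : Type*} [Fintype I] [Nonempty I]
    (g : stdSimplex ℝ I → I → ℝ) (hg : Continuous g) (hle : ∀ x, ∑ i, x.1 i * g x i ≤ 0) :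
    ∃ x, ∀ i, g x i ≤ 0 := by
  let G : stdSimplex ℝ I → ℝ := fun x => ∑ i, max (g x i) 0
  have hG : ∀ x, 0 ≤ G x := fun x => Finset.sum_nonneg fun i _ => le_max_right _ _
  have hgi : ∀ i, Continuous fun x => g x i := fun i => (continuous_apply i).comp hg
  have hGc : Continuous G := continuous_finsetSum _ fun i _ => (hgi i).max continuous_const
  have hG1 : ∀ x, 0 < 1 + G x := fun x => by linarith [hG x]
  -- the map of Nash: mass is moved towards the coordinates where `g` is positive
  let f : stdSimplex ℝ I → stdSimplex ℝ I := fun x =>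
    ⟨fun i => (x.1 i + max (g x i) 0) / (1 + G x),
      fun i => div_nonneg (add_nonneg (x.2.1 i) (le_max_right _ _)) (hG1 x).le, by
        rw [← Finset.sum_div, Finset.sum_add_distrib, x.2.2, div_self (hG1 x).ne']⟩
  have hf : Continuous f := by
    refine Continuous.subtype_mk (continuous_pi fun i => ?_) _
    exact (((continuous_apply i).comp continuous_subtype_val).add
      ((hgi i).max continuous_const)).div (continuous_const.add hGc) fun x => (hG1 x).ne'
  obtain ⟨x, hx⟩ := exists_fixedPoint_stdSimplex f hf
  have hxi : ∀ i, max (g x i) 0 = x.1 i * G x := by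
    intro i
    have h : (x.1 i + max (g x i) 0) / (1 + G x) = x.1 i := congrFun (congrArg Subtype.val hx) i
    rw [div_eq_iff (hG1 x).ne'] at h
    linarith
  have hsum : ∑ i, max (g x i) 0 * max (g x i) 0 ≤ 0 := by
    have h : ∀ i, max (g x i) 0 * max (g x i) 0 = G x * (x.1 i * g x i) := by
      intro i
      rcases le_total (g x i) 0 with h | h
      · have h0 := hxi i
        rw [max_eq_right h] at h0 ⊢
        linear_combination g x i * h0
      · have h0 := hxi i
        rw [max_eq_left h] at h0 ⊢
        linear_combination g x i * h0
    rw [Finset.sum_congr rfl fun i _ => h i, ← Finset.mul_sum]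
    exact mul_nonpos_of_nonneg_of_nonpos (hG x) (hle x)
  refine ⟨x, fun i => ?_⟩
  have h0 := (Finset.sum_eq_zero_iff_of_nonneg fun i _ => mul_self_nonneg (max (g x i) 0)).1
    (le_antisymm hsum (Finset.sum_nonneg fun i _ => mul_self_nonneg _)) i (Finset.mem_univ i)
  exact max_eq_right_iff.1 (mul_self_eq_zero.1 h0)

end Brouwer

/-! ### A Ky Fan inequality for forecasts -/

section Forecasts

open Filter Topology TopologicalSpace

variable {Ω : Type*} [MeasurableSpace Ω]

/-- The probability measure with weights `x i` at the points `a i`. -/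
noncomputable def finiteMixture {I : Type*} [Fintype I] (a : I → Ω) (x : stdSimplex ℝ I) :
    ProbabilityMeasure Ω :=
  ⟨∑ i, ENNReal.ofReal (x.1 i) • Measure.dirac (a i), ⟨by
    simp only [Measure.coe_finsetSum, Finset.sum_apply, Measure.smul_apply, measure_univ,
      smul_eq_mul, mul_one]
    rw [← ENNReal.ofReal_sum_of_nonneg fun i _ => x.2.1 i, x.2.2, ENNReal.ofReal_one]⟩⟩

theorem integral_finiteMixture [MeasurableSingletonClass Ω] {I : Type*} [Fintype I] (a : I → Ω)
    (x : stdSimplex ℝ I) (f : Ω → ℝ) :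
    ∫ ω, f ω ∂(finiteMixture a x : Measure Ω) = ∑ i, x.1 i * f (a i) := by
  have h : ∀ i, Integrable f (ENNReal.ofReal (x.1 i) • Measure.dirac (a i)) := fun i =>
    (integrable_dirac (by simp)).smul_measure (by simp)
  change ∫ ω, f ω ∂(∑ i, ENNReal.ofReal (x.1 i) • Measure.dirac (a i)) = _
  rw [integral_finsetSum_measure fun i _ => h i]
  refine Finset.sum_congr rfl fun i _ => ?_
  rw [integral_smul_measure, integral_dirac, ENNReal.toReal_ofReal (x.2.1 i), smul_eq_mul]

variable [TopologicalSpace Ω] [BorelSpace Ω]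

theorem continuous_finiteMixture [MeasurableSingletonClass Ω] {I : Type*} [Fintype I]
    (a : I → Ω) : Continuous (finiteMixture a) := by
  refine ProbabilityMeasure.continuous_iff_forall_continuous_integral.2 fun f => ?_
  simp only [integral_finiteMixture]
  exact continuous_finsetSum _ fun i _ =>
    ((continuous_apply i).comp continuous_subtype_val).mul continuous_const

variable [CompactSpace Ω] [MetrizableSpace Ω]

/-- A Ky Fan inequality for forecasts. For finitely many outcomes it is the variational inequality
on the simplex that they span, and compactness of the space of forecasts does the rest. -/
theorem exists_forecast_forall_nonpos [Nonempty Ω] (F : Ω → ProbabilityMeasure Ω → ℝ)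
    (hF : ∀ ω, Continuous (F ω))
    (hle : ∀ p : ProbabilityMeasure Ω, ∫ ω, F ω p ∂(p : Measure Ω) ≤ 0) :
    ∃ p, ∀ ω, F ω p ≤ 0 := by
  obtain ⟨p, hp⟩ := CompactSpace.iInter_nonempty (t := fun ω => {p | F ω p ≤ 0})
    (fun ω => isClosed_le (hF ω) continuous_const) (fun s => by
      rcases s.eq_empty_or_nonempty with rfl | hs
      · exact ⟨diracProba (Classical.arbitrary Ω), by simp⟩
      have : Nonempty s := hs.to_subtype
      obtain ⟨x, hx⟩ := exists_forall_nonpos_of_sum_mul_nonpos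
        (fun (x : stdSimplex ℝ s) (i : s) => F i (finiteMixture (fun i : s => (i : Ω)) x))
        (continuous_pi fun i => (hF i).comp (continuous_finiteMixture _)) (fun x => by
          have h := hle (finiteMixture (fun i : s => (i : Ω)) x)
          rwa [integral_finiteMixture] at h)
      exact ⟨finiteMixture _ x, Set.mem_iInter₂.2 fun i hi => hx ⟨i, hi⟩⟩)
  exact ⟨p, fun ω => Set.mem_iInter.1 hp ω⟩

/-- If the bet `S · q` is fair under each forecast `q`, some mixture of the bets at finitely many
forecasts is almost nowhere profitable, and the forecasts involved can be chosen so that their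
prescribed neighbourhoods `W q` have a common point. The mixing weights are the values at that
point of a partition of unity, which makes the mixed bet depend continuously on the point. -/
theorem exists_local_mixture_le [Nonempty Ω] {S : Ω → ProbabilityMeasure Ω → ℝ}
    (hS : ∀ q, Continuous fun ω => S ω q)
    (hle : ∀ q : ProbabilityMeasure Ω, ∫ ω, S ω q ∂(q : Measure Ω) ≤ 0) {δ : ℝ} (hδ : 0 < δ)
    (W : ProbabilityMeasure Ω → Set (ProbabilityMeasure Ω)) (hW : ∀ q, W q ∈ 𝓝 q) :
    ∃ (p : ProbabilityMeasure Ω) (t : Finset (ProbabilityMeasure Ω))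
      (w : ProbabilityMeasure Ω → ℝ), (∀ q ∈ t, 0 < w q) ∧ ∑ q ∈ t, w q = 1 ∧
      (∀ q ∈ t, p ∈ W q) ∧ ∀ ω, ∑ q ∈ t, w q * S ω q ≤ δ := by
  classical
  have hint : ∀ q (p : ProbabilityMeasure Ω), Integrable (fun ω => S ω q) (p : Measure Ω) :=
    fun q p => (hS q).integrable_of_hasCompactSupport (HasCompactSupport.of_compactSpace _)
  let U : ProbabilityMeasure Ω → Set (ProbabilityMeasure Ω) := fun q =>
    {p | ∫ ω, S ω q ∂(p : Measure Ω) < δ} ∩ interior (W q)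
  have hUo : ∀ q, IsOpen (U q) := fun q =>
    (isOpen_lt (ProbabilityMeasure.continuous_integral_continuousMap (⟨_, hS q⟩ : C(Ω, ℝ)))
      continuous_const).inter isOpen_interior
  obtain ⟨t, -, ht⟩ := isCompact_univ.elim_nhds_subcover U fun q _ =>
    (hUo q).mem_nhds ⟨(hle q).trans_lt hδ, mem_interior_iff_mem_nhds.2 (hW q)⟩
  obtain ⟨ρ, hρ⟩ := PartitionOfUnity.exists_isSubordinate_of_locallyFinite isClosed_univ
    (fun q : t => U q) (fun q => hUo q) (locallyFinite_of_finite _) fun p hp => by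
      obtain ⟨q, hq, hpq⟩ := Set.mem_iUnion₂.1 (ht hp)
      exact Set.mem_iUnion.2 ⟨⟨q, hq⟩, hpq⟩
  have hρU : ∀ q p, ρ q p ≠ 0 → p ∈ U q := fun q p h => hρ q (subset_tsupport _ h)
  have hρsum : ∀ p, ∑ q, ρ q p = 1 := fun p => by
    rw [← finsum_eq_sum_of_fintype]
    exact ρ.sum_eq_one (Set.mem_univ p)
  obtain ⟨p, hp⟩ := exists_forecast_forall_nonpos (fun ω p => ∑ q, ρ q p * (S ω q - δ))
    (fun ω => continuous_finsetSum _ fun q _ => (ρ q).continuous.mul continuous_const)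
    (fun p => by
      have hterm : ∀ q : t, Integrable (fun ω => ρ q p * (S ω q - δ)) (p : Measure Ω) := fun q =>
        ((hint q p).sub (integrable_const δ)).const_mul (ρ q p)
      rw [integral_finsetSum _ fun q _ => hterm q]
      refine Finset.sum_nonpos fun q _ => ?_
      rw [integral_const_mul, integral_sub (hint q p) (integrable_const δ)]
      by_cases h : ρ q p = 0
      · simp [h]
      · refine mul_nonpos_of_nonneg_of_nonpos (ρ.nonneg q p) ?_
        have : ∫ ω, S ω q ∂(p : Measure Ω) < δ := (hρU q p h).1
        simpa using this.le)
  let w : ProbabilityMeasure Ω → ℝ := fun q => if hq : q ∈ t then ρ ⟨q, hq⟩ p else 0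
  have hw : ∀ q : t, w q = ρ q p := fun q => dif_pos q.2
  have hsum : ∀ f : ProbabilityMeasure Ω → ℝ,
      ∑ q ∈ t with w q ≠ 0, w q * f q = ∑ q : t, ρ q p * f q := fun f => by
    rw [Finset.sum_filter_of_ne fun q _ h => left_ne_zero_of_mul h, ← Finset.sum_coe_sort]
    exact Finset.sum_congr rfl fun q _ => by rw [hw]
  refine ⟨p, t.filter fun q => w q ≠ 0, w, fun q hq => ?_, ?_, fun q hq => ?_, fun ω => ?_⟩
  · obtain ⟨hqt, hq0⟩ := Finset.mem_filter.1 hq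
    refine lt_of_le_of_ne ?_ hq0.symm
    rw [hw ⟨q, hqt⟩]
    exact ρ.nonneg _ p
  · simpa only [mul_one, hρsum] using hsum fun _ => 1
  · obtain ⟨hqt, hq0⟩ := Finset.mem_filter.1 hq
    rw [hw ⟨q, hqt⟩] at hq0
    exact interior_subset (hρU _ p hq0).2
  · have h := hp ω
    simp only [mul_sub, Finset.sum_sub_distrib, ← Finset.sum_mul, hρsum] at h
    rw [hsum]
    linarith

end Forecasts

/-! ### Reducing the number of forecasts -/

section Weights

/-- **Carathéodory's theorem for cones**: a positive combination of vectors in a space of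
dimension `d` is a positive combination of at most `d` of them. -/
theorem exists_pos_combination_card_le_finrank {ι E : Type*} [AddCommGroup E] [Module ℝ E]
    [FiniteDimensional ℝ E] (v : ι → E) (t : Finset ι) (w : ι → ℝ) (hw : ∀ i ∈ t, 0 < w i) :
    ∃ s ⊆ t, ∃ u : ι → ℝ, (∀ i ∈ s, 0 < u i) ∧ ∑ i ∈ s, u i • v i = ∑ i ∈ t, w i • v i ∧
      s.card ≤ Module.finrank ℝ E := by
  classical
  induction t using Finset.strongInduction generalizing w with
  | H t ih =>
    by_cases hli : LinearIndependent ℝ fun i : t => v i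
    · exact ⟨t, subset_rfl, w, hw, rfl, by simpa using hli.fintype_card_le_finrank⟩
    obtain ⟨g, hg, hne⟩ : ∃ g : ι → ℝ, ∑ i ∈ t, g i • v i = 0 ∧ ∃ i ∈ t, 0 < g i := by
      obtain ⟨g, hg, i, hi⟩ := Fintype.not_linearIndependent_iff.1 hli
      have key : ∀ g : t → ℝ, ∑ i : t, g i • v i = 0 → 0 < g i →
          ∃ g : ι → ℝ, ∑ i ∈ t, g i • v i = 0 ∧ ∃ i ∈ t, 0 < g i := fun g hg hi =>
        ⟨fun j => if hj : j ∈ t then g ⟨j, hj⟩ else 0, by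
          rw [← Finset.sum_coe_sort, ← hg]
          exact Finset.sum_congr rfl fun j _ => by simp, i, i.2, by simpa using hi⟩
      rcases hi.lt_or_gt with hi | hi
      · exact key (fun j => -g j) (by simp only [neg_smul, Finset.sum_neg_distrib, hg, neg_zero])
          (neg_pos.2 hi)
      · exact key g hg hi
    -- subtract the relation with the largest factor that keeps all the weights nonnegative
    obtain ⟨k, hk, hmin⟩ := Finset.exists_min_image (t.filter fun i => 0 < g i)
      (fun i => w i / g i) (by simpa [Finset.filter_nonempty_iff] using hne)
    obtain ⟨hkt, hgk⟩ := Finset.mem_filter.1 hk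
    let u : ι → ℝ := fun i => w i - w k / g k * g i
    have huk : u k = 0 := by simp [u, hgk.ne']
    have hu : ∀ i ∈ t, 0 ≤ u i := by
      intro i hi
      rcases le_or_gt (g i) 0 with h | h
      · have h1 := mul_nonpos_of_nonneg_of_nonpos (div_pos (hw k hkt) hgk).le h
        have h2 := hw i hi
        simp only [u]
        linarith
      · have h1 := (le_div_iff₀ h).1 (hmin i (Finset.mem_filter.2 ⟨hi, h⟩))
        simp only [u]
        linarith
    have hsum : ∑ i ∈ t with u i ≠ 0, u i • v i = ∑ i ∈ t, w i • v i := by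
      rw [Finset.sum_filter_of_ne fun i _ h => left_ne_zero_of_smul h]
      simp only [u, sub_smul, mul_smul, Finset.sum_sub_distrib, ← Finset.smul_sum, hg, smul_zero,
        sub_zero]
    obtain ⟨s, hs, u', hu', hsum', hcard⟩ := ih (t.filter fun i => u i ≠ 0)
      (Finset.filter_ssubset.2 ⟨k, hkt, by simp [huk]⟩) u fun i hi => by
        obtain ⟨hit, hi0⟩ := Finset.mem_filter.1 hi
        exact lt_of_le_of_ne (hu i hit) hi0.symm
    exact ⟨s, hs.trans (Finset.filter_subset _ _), u', hu', hsum'.trans hsum, hcard⟩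

theorem RandomizedGame.FinProb.sum_weight {X : Type*} (P : RandomizedGame.FinProb X) :
    ∑ x ∈ P.D, P.weight x = 1 := by
  have h : P.1.toOuterMeasure (P.D : Set X) = 1 := P.D_isLeast.1
  rw [PMF.toOuterMeasure_apply_finset] at h
  simp only [FinProb.weight]
  rw [← ENNReal.toReal_sum fun x _ => P.1.apply_ne_top x, h, ENNReal.toReal_one]

open RandomizedGame in
theorem RandomizedGame.FinProb.exists_of_weights {X : Type*} (t : Finset X) (w : X → ℝ)
    (hw : ∀ x ∈ t, 0 < w x) (hsum : ∑ x ∈ t, w x = 1) :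
    ∃ P : FinProb X, P.D = t ∧ ∀ f, P.integral f = ∑ x ∈ t, w x * f x := by
  classical
  let P : PMF X := PMF.ofFinset (fun x => if x ∈ t then ENNReal.ofReal (w x) else 0) t
    (by
      rw [Finset.sum_congr rfl fun x hx => if_pos hx,
        ← ENNReal.ofReal_sum_of_nonneg fun x hx => (hw x hx).le, hsum, ENNReal.ofReal_one])
    (fun x hx => if_neg hx)
  have hP : ∀ x ∈ t, P x = ENNReal.ofReal (w x) := fun x hx => if_pos hx
  have hsupp : P.support = t := by
    ext x
    rw [PMF.mem_support_iff, Finset.mem_coe]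
    by_cases hx : x ∈ t
    · simp [hP x hx, hx, hw x hx]
    · simp only [hx, iff_false, not_not]
      exact if_neg hx
  have hD : FinProb.D ⟨P, hsupp ▸ t.finite_toSet⟩ = t := by
    ext x
    simp [FinProb.D, hsupp]
  refine ⟨⟨P, hsupp ▸ t.finite_toSet⟩, hD, fun f => ?_⟩
  change ∑ x ∈ FinProb.D _, FinProb.weight _ x * f x = _
  rw [hD]
  refine Finset.sum_congr rfl fun x hx => ?_
  change (P x).toReal * f x = _
  rw [hP x hx, ENNReal.toReal_ofReal (hw x hx).le]

end Weights

/-! ### Forecaster's strategy -/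

section Strategy

open Filter Topology TopologicalSpace RandomizedGame

/-- Forecaster's randomized forecast in a single round: it makes Sceptic's expected gain at most
`δ` whatever the outcome, on a set of diameter at most `η` with at most `|Ω|` points. -/
theorem exists_finProb_integral_le {Ω : Type*} [MeasurableSpace Ω] [TopologicalSpace Ω]
    [BorelSpace Ω] [CompactSpace Ω] [MetrizableSpace Ω] [Nonempty Ω]
    {d : ProbabilityMeasure Ω → ProbabilityMeasure Ω → ℝ} (hsymm : ∀ p q, d p q = d q p)
    (htri : ∀ p q q', d p q' ≤ d p q + d q q')
    (hnhds : ∀ q η, 0 < η → {p | d p q < η} ∈ 𝓝 q) {S : Ω → ProbabilityMeasure Ω → ℝ}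
    (hS : ∀ q, Continuous fun ω => S ω q)
    (hle : ∀ q : ProbabilityMeasure Ω, ∫ ω, S ω q ∂(q : Measure Ω) ≤ 0) {δ η : ℝ} (hδ : 0 < δ)
    (hη : 0 < η) :
    ∃ P : FinProb (ProbabilityMeasure Ω), diam d P.D ≤ η ∧ (P.D.card : ℕ∞) ≤ ENat.card Ω ∧
      ∀ ω, P.integral (S ω) ≤ δ := by
  obtain ⟨p, t, w, hw, hw1, hp, hwS⟩ := exists_local_mixture_le hS hle (half_pos hδ)
    (fun q => {p | d p q < η / 2}) fun q => hnhds q _ (half_pos hη)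
  have hdiam : ∀ P : FinProb (ProbabilityMeasure Ω), P.D ⊆ t → diam d P.D ≤ η := by
    intro P hP
    obtain ⟨q, hq, q', hq', h⟩ := (diam_isGreatest d P.D_nonempty).1
    have h1 : d p q < η / 2 := hp q (hP hq)
    have h2 : d p q' < η / 2 := hp q' (hP hq')
    have h3 := htri q p q'
    rw [hsymm q p] at h3
    linarith
  rcases finite_or_infinite Ω with hΩ | hΩ
  · have := Fintype.ofFinite Ω
    -- The half of `δ` held back makes the combination of the vectors `S · q - δ` nonzero,
    -- so that the weights still have a positive sum after the reduction of their number.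
    obtain ⟨s, hst, u, hu, hus, hcard⟩ := exists_pos_combination_card_le_finrank
      (fun q ω => S ω q - δ) t w hw
    have hneg : ∀ ω, ∑ q ∈ s, u q * (S ω q - δ) < 0 := by
      intro ω
      have h := congrFun hus ω
      simp only [Finset.sum_apply, Pi.smul_apply, smul_eq_mul] at h
      rw [h]
      simp only [mul_sub, Finset.sum_sub_distrib, ← Finset.sum_mul, hw1]
      linarith [hwS ω]
    have hs : s.Nonempty := by
      rw [Finset.nonempty_iff_ne_empty]
      rintro rfl
      simpa using hneg (Classical.arbitrary Ω)
    have hpos : 0 < ∑ q ∈ s, u q := Finset.sum_pos hu hs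
    obtain ⟨P, hPD, hP⟩ := FinProb.exists_of_weights s (fun q => u q / ∑ q ∈ s, u q)
      (fun q hq => div_pos (hu q hq) hpos) (by rw [← Finset.sum_div, div_self hpos.ne'])
    refine ⟨P, hdiam P (hPD ▸ hst), ?_, fun ω => ?_⟩
    · rw [hPD, ENat.card_eq_coe_fintype_card]
      simpa using hcard
    · have h := hneg ω
      simp only [mul_sub, Finset.sum_sub_distrib, ← Finset.sum_mul] at h
      rw [hP]
      simp only [div_mul_eq_mul_div]
      rw [← Finset.sum_div, div_le_iff₀ hpos]
      linarith
  · obtain ⟨P, hPD, hP⟩ := FinProb.exists_of_weights t w hw hw1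
    refine ⟨P, hdiam P hPD.le, by simp, fun ω => ?_⟩
    rw [hP]
    linarith [hwS ω]

/-- Forecaster's strategy keeps his capital equal to `(K + ε / 2 ^ n) / (1 + ε)`, where `K` is the
capital of Sceptic after `n` rounds. Of the distance `d` only symmetry, the triangle inequality and
the fact that balls are neighbourhoods of their centres in the weak topology are used. -/
theorem forecasterCanGuarantee_of_nhds {Ω : Type*} [MeasurableSpace Ω] [TopologicalSpace Ω]
    [BorelSpace Ω] [CompactSpace Ω] [MetrizableSpace Ω] [Nonempty Ω]
    {d : ProbabilityMeasure Ω → ProbabilityMeasure Ω → ℝ} (hsymm : ∀ p q, d p q = d q p)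
    (htri : ∀ p q q', d p q' ≤ d p q + d q q')
    (hnhds : ∀ q η, 0 < η → {p | d p q < η} ∈ 𝓝 q) {ε : ℝ} (hε : 0 < ε) {e : ℕ → ℝ}
    (he : ∀ n, 0 < e n) : ForecasterCanGuarantee d ε e := by
  classical
  let Good : ℕ → (Ω → ProbabilityMeasure Ω → ℝ) → FinProb (ProbabilityMeasure Ω) → Prop :=
    fun n S P => diam d P.D ≤ e n ∧ (P.D.card : ℕ∞) ≤ ENat.card Ω ∧
      ∀ ω, P.integral (S ω) ≤ ε / 2 ^ (n + 1)
  have hgood : ∀ n K S, LegalScepticMove K S → ∃ P, Good n S P := fun n K S hS =>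
    exists_finProb_integral_le hsymm htri hnhds hS.continuous hS.integral_nonpos
      (by positivity) (he n)
  obtain ⟨P₀, -⟩ : ∃ P : FinProb (ProbabilityMeasure Ω), P.D = {diracProba (Classical.arbitrary Ω)} ∧
      ∀ f, P.integral f = _ :=
    FinProb.exists_of_weights _ (fun _ => 1) (by simp) (by simp)
  let σ : Strategy Ω :=
    { forecast := fun h S => if hS : ∃ P, Good h.length S P then hS.choose else P₀
      bet := fun h S ω p => (S ω p - ε / 2 ^ (h.length + 1)) / (1 + ε) }
  have hlen : ∀ (r : ℕ → Round Ω) n, (history r n).length = n := fun r n => by simp [history]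
  have hf : ∀ r n p, σ.f r n p = ((r n).S (r n).outcome p - ε / 2 ^ (n + 1)) / (1 + ε) :=
    fun r n p => by simp only [Strategy.f, σ, hlen]
  have hP : ∀ r, LegalPlay σ r → ∀ n, Good n (r n).S (σ.P r n) := by
    intro r hr n
    have h := hgood n _ _ (hr.sceptic n)
    simp only [Strategy.P, σ, hlen]
    rw [dif_pos h]
    exact h.choose_spec
  have h1ε : 0 < 1 + ε := by linarith
  have hcap : ∀ r n, (1 + ε) * σ.capital r n = scepticCapital r n + ε / 2 ^ n := by
    intro r n
    induction n with
    | zero => simp [Strategy.capital, scepticCapital]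
    | succ n ih =>
      rw [Strategy.capital, scepticCapital, hf, mul_add, ih, mul_div_cancel₀ _ h1ε.ne', pow_succ]
      ring
  have hK : ∀ r, LegalPlay σ r → ∀ n, 0 ≤ scepticCapital r n := by
    intro r hr n
    cases n with
    | zero => simp [scepticCapital]
    | succ n => exact (hr.sceptic n).capital_nonneg _ _
  refine ⟨σ, ⟨fun r hr n => ?_, fun r hr n => ?_⟩, fun r hr => ⟨fun n => ?_, fun n => (hP r hr n).1,
    fun n => (hP r hr n).2.1⟩⟩
  · have h := (hP r hr n).2.2 (r n).outcome
    rw [FinProb.integral] at h ⊢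
    simp only [hf]
    generalize ε / 2 ^ (n + 1) = c at h ⊢
    simp only [mul_div_assoc', mul_sub]
    rw [← Finset.sum_div, Finset.sum_sub_distrib, ← Finset.sum_mul, FinProb.sum_weight, one_mul]
    exact div_nonpos_of_nonpos_of_nonneg (by linarith) h1ε.le
  · have h := hcap r n
    have h2 : 0 < ε / 2 ^ n := by positivity
    exact (pos_of_mul_pos_right (by linarith [hK r hr n]) h1ε.le).le
  · have h2 : 0 < ε / 2 ^ n := by positivity
    linarith [hcap r n]

end Strategy

/-! ### The distances on forecasts -/

section Distances

open Filter Topology RandomizedGame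

theorem continuous_measureReal_singleton {Ω : Type*} [TopologicalSpace Ω] [DiscreteTopology Ω]
    [MeasurableSpace Ω] [BorelSpace Ω] (ω : Ω) :
    Continuous fun p : ProbabilityMeasure Ω => (p : Measure Ω).real {ω} := by
  -- the indicator function of a point is continuous
  let f : BoundedContinuousFunction Ω ℝ := BoundedContinuousFunction.ofNormedAddCommGroup
    (Set.indicator {ω} 1) continuous_of_discreteTopology 1 fun x => by
      by_cases hx : x = ω <;> simp [hx]
  refine (ProbabilityMeasure.continuous_integral_boundedContinuousFunction f).congr fun p => ?_
  exact integral_indicator_one (measurableSet_singleton ω)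

theorem setOf_euclideanDist_lt_mem_nhds {Ω : Type*} [Fintype Ω] [TopologicalSpace Ω]
    [DiscreteTopology Ω] [MeasurableSpace Ω] [BorelSpace Ω] (q : ProbabilityMeasure Ω) {η : ℝ}
    (hη : 0 < η) : {p | euclideanDist p q < η} ∈ 𝓝 q := by
  have h : Continuous fun p => euclideanDist p q :=
    ((PiLp.continuous_toLp 2 _).comp
      (continuous_pi fun ω => continuous_measureReal_singleton ω)).dist continuous_const
  exact (isOpen_lt h continuous_const).mem_nhds (by simpa [euclideanDist] using hη)

theorem setOf_prokhorovDist_lt_mem_nhds {Ω : Type*} [MetricSpace Ω] [CompactSpace Ω]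
    [MeasurableSpace Ω] [BorelSpace Ω] (q : ProbabilityMeasure Ω) {η : ℝ}
    (hη : 0 < η) : {p | prokhorovDist p q < η} ∈ 𝓝 q := by
  have h : Continuous fun p : ProbabilityMeasure Ω => prokhorovDist p q :=
    (LevyProkhorov.continuous_ofMeasure_probabilityMeasure (Ω := Ω)).dist
      (continuous_const (y := LevyProkhorov.ofMeasure q))
  exact (isOpen_lt h continuous_const).mem_nhds (by
    simpa [prokhorovDist, levyProkhorovDist_self] using hη)

end Distances

theorem mainTheorem4 (ε : ℝ) (hε : 0 < ε) (e : ℕ → ℝ) (he : ∀ n, 0 < e n) :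
    -- finite outcome space, Euclidean distance on the simplex
    (∀ (Ω : Type*) [Fintype Ω] [Nonempty Ω] [TopologicalSpace Ω] [DiscreteTopology Ω]
        [MeasurableSpace Ω] [BorelSpace Ω],
      RandomizedGame.ForecasterCanGuarantee (Ω := Ω) RandomizedGame.euclideanDist ε e) ∧
    -- compact metric outcome space, Prokhorov distance
    (∀ (Ω : Type*) [MetricSpace Ω] [CompactSpace Ω] [Nonempty Ω]
        [MeasurableSpace Ω] [BorelSpace Ω],
      RandomizedGame.ForecasterCanGuarantee (Ω := Ω) RandomizedGame.prokhorovDist ε e) ∧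
    -- compact metric outcome space, any metric that induces the topology of weak convergence
    (∀ (Ω : Type*) [MetricSpace Ω] [CompactSpace Ω] [Nonempty Ω]
        [MeasurableSpace Ω] [BorelSpace Ω] (m : MetricSpace (MeasureTheory.ProbabilityMeasure Ω)),
      m.toUniformSpace.toTopologicalSpace =
          MeasureTheory.ProbabilityMeasure.instTopologicalSpace →
      RandomizedGame.ForecasterCanGuarantee (Ω := Ω) (fun p q => m.dist p q) ε e) := by
  refine ⟨?_, ?_, ?_⟩
  · intro Ω _ _ _ _ _ _
    exact forecasterCanGuarantee_of_nhds (d := RandomizedGame.euclideanDist)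
      (fun p q => dist_comm _ _)
      (fun p q q' => dist_triangle _ _ _)
      (fun q η hη => setOf_euclideanDist_lt_mem_nhds q hη) hε he
  · intro Ω _ _ _ _ _
    exact forecasterCanGuarantee_of_nhds (d := RandomizedGame.prokhorovDist)
      (fun p q => levyProkhorovDist_comm _ _)
      (fun p q q' => levyProkhorovDist_triangle _ _ _)
      (fun q η hη => setOf_prokhorovDist_lt_mem_nhds q hη) hε he
  · intro Ω _ _ _ _ _ m hm
    refine forecasterCanGuarantee_of_nhds (fun p q => @dist_comm _ m.toPseudoMetricSpace p q)
      (fun p q q' => @dist_triangle _ m.toPseudoMetricSpace p q q') (fun q η hη => ?_) hε he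
    rw [← hm]
    exact @Metric.ball_mem_nhds _ m.toPseudoMetricSpace q η hη
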